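/- Let $q$ be a power of a prime $p$, and let $e,k$ be nontrivial divisors of $q-1$ (that is, different from $1$ and $q-1$) with $q=ek+1$. Let $g$ be a primitive element of the finite field $\mathbb{F}_q$. For $a\in\mathbb{Z}$ put $C_a=\{g^{a},g^{a+e},\dots,g^{a+(k-1)e}\}$, and for $a,b\in\mathbb{Z}$ let the cyclotomic number $(a,b)$ of order $e$ be the number of solutions of $1+x=y$ with $x\in C_a$ and $y\in C_b$. Let $\mathrm{ord}_k(p)$ denote the multiplicative order of $p$ modulo $k$. If $$p>\left(\sqrt{14}\right)^{k/\mathrm{ord}_k(p)},$$ then $(a,b)\le 3$ for all $a,b\in\mathbb{Z}$. -/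

import Mathlib

/-- The cyclotomic class `C_a = {g ^ a, g ^ (a + e), …, g ^ (a + (k - 1) e)}` in a field `F`,
with respect to the unit `g` and the integer `a`. -/
def cyclotomicClass {F : Type*} [Field F] (g : Fˣ) (e k : ℕ) (a : ℤ) : Set F :=
  {x | ∃ r : ℕ, r < k ∧ x = ((g ^ (a + (r : ℤ) * (e : ℤ)) : Fˣ) : F)}

/-- The cyclotomic number `(a, b)` of order `e`: the number of solutions of
`1 + x = y` with `x ∈ C_a` and `y ∈ C_b`. -/
noncomputable def cyclotomicNumber {F : Type*} [Field F] (g : Fˣ) (e k : ℕ) (a b : ℤ) : ℕ :=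
  Set.ncard {z : F × F |
    z.1 ∈ cyclotomicClass g e k a ∧ z.2 ∈ cyclotomicClass g e k b ∧ 1 + z.1 = z.2}

/-! The argument yields the stronger bound 2. Three solutions give three points `(z ^ m i, z ^ n
i)`, `z = g ^ e`, on the line `1 + αx = βy`, so the determinant with rows `(1, z ^ m i, z ^ n i)`
vanishes: a signed sum of six `k`-th roots of unity is zero in `F`. Lift it to `ℤ[ζ_k]`. If the lift
is nonzero, its norm is at least `p ^ f`, `f = ord_k(p)` (`pow_orderOf_le_natAbs_norm`), while
Parseval and AM-GM bound the squared norm by `14 ^ k` (`norm_sq_le_pow_of_sum_le`); this contradicts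
the hypothesis on `p`. If the lift is zero, complex conjugation makes two of the points
proportional, which is impossible on a line missing the origin. -/

namespace CyclotomicBound

open Polynomial

/-! ### Lower bound for the norm, by reduction to characteristic `p`. -/

/-- A finite field of characteristic `p` with a primitive `k`-th root of unity has at least
`p ^ f` elements, where `f` is the order of `p` modulo `k`. -/
theorem pow_orderOf_le_natCard_of_isPrimitiveRoot {L : Type*} [Field L] [Finite L] {p k : ℕ}
    [CharP L p] [NeZero k] {y : L} (hy : IsPrimitiveRoot y k) :
    p ^ orderOf (p : ZMod k) ≤ Nat.card L := by
  have : Fintype L := Fintype.ofFinite _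
  obtain ⟨m, hp, hcard⟩ := FiniteField.card L p
  have hdvd : k ∣ p ^ (m : ℕ) - 1 := by
    rw [← hcard]
    exact hy.dvd_of_pow_eq_one _ (FiniteField.pow_card_sub_one_eq_one _
      (hy.ne_zero (NeZero.ne k)))
  have hord : orderOf (p : ZMod k) ∣ m := by
    rw [orderOf_dvd_iff_pow_eq_one]
    have := (ZMod.natCast_eq_zero_iff _ _).2 hdvd
    rw [Nat.cast_sub (Nat.one_le_pow _ _ hp.pos)] at this
    push_cast at this
    exact sub_eq_zero.1 this
  rw [Nat.card_eq_fintype_card, hcard]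
  exact Nat.pow_le_pow_right hp.pos (Nat.le_of_dvd m.pos hord)

/-- A finite domain of characteristic `p` with a primitive `k`-th root of unity has at least
`p ^ f` elements, where `f` is the order of `p` modulo `k`. -/
theorem pow_orderOf_le_natCard_of_isPrimitiveRoot_of_isDomain {R : Type*} [CommRing R] [IsDomain R]
    [Finite R] {p k : ℕ} [h : CharP R p] [NeZero k] {y : R} (hy : IsPrimitiveRoot y k) :
    p ^ orderOf (p : ZMod k) ≤ Nat.card R :=
  @pow_orderOf_le_natCard_of_isPrimitiveRoot R (Finite.isDomain_to_isField R).toField _ p k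
    h _ y hy

/-- The norm of a nonzero integral element of a cyclotomic field that is annihilated by a
reduction map to a field of characteristic `p` is at least `p ^ f`, where `f` is the order of `p`
modulo `k`. -/
theorem pow_orderOf_le_natAbs_norm {F K : Type*} [Field F] [Finite F] [Field K] [NumberField K]
    {p k : ℕ} [CharP F p] [NeZero k] [IsCyclotomicExtension {k} ℚ K] {z : F}
    (hz : IsPrimitiveRoot z k) {ζ : K} (hζ : IsPrimitiveRoot ζ k) (X : ℤ[X])
    (hX : aeval z X = 0) (hX' : aeval hζ.toInteger X ≠ 0) :
    p ^ orderOf (p : ZMod k) ≤ (Algebra.norm ℤ (aeval hζ.toInteger X)).natAbs := by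
  have hgen := hζ.integralPowerBasis_gen
  -- `z` is a root of the `k`-th cyclotomic polynomial, so `ζ ↦ z` extends to a ring homomorphism on
  -- the integers of `K`.
  have hmin : aeval z (minpoly ℤ hζ.integralPowerBasis.gen) = 0 := by
    rw [hgen, ← minpoly.algebraMap_eq (B' := K) NumberField.RingOfIntegers.coe_injective,
      show algebraMap _ K hζ.toInteger = ζ from rfl,
      ← cyclotomic_eq_minpoly hζ (NeZero.pos k), aeval_def,
      eval₂_eq_eval_map, map_cyclotomic]
    exact hz.isRoot_cyclotomic (NeZero.pos k)
  set φ := hζ.integralPowerBasis.lift z hmin with hφ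
  have hφX (f : ℤ[X]) : φ (aeval hζ.toInteger f) = aeval z f := by
    rw [← hgen, hφ, PowerBasis.lift_aeval]
  -- The index of the kernel is the size of the image, a finite domain containing a primitive `k`-th
  -- root of unity.
  have hker : p ^ orderOf (p : ZMod k) ≤ Ideal.absNorm (RingHom.ker φ.toRingHom) := by
    rw [Ideal.absNorm_apply, Submodule.cardQuot_apply,
      Nat.card_congr (RingHom.quotientKerEquivRange φ.toRingHom).toEquiv]
    have hroot : IsPrimitiveRoot (φ.toRingHom.rangeRestrict hζ.toInteger) k := by
      apply IsPrimitiveRoot.of_map_of_injective (f := φ.toRingHom.range.subtype) _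
        Subtype.val_injective
      have : φ hζ.toInteger = z := by simpa only [aeval_X] using hφX Polynomial.X
      change IsPrimitiveRoot (φ hζ.toInteger) k
      rwa [this]
    have : CharP φ.toRingHom.range p :=
      RingHom.charP φ.toRingHom.range.subtype Subtype.val_injective p
    exact pow_orderOf_le_natCard_of_isPrimitiveRoot_of_isDomain hroot
  have hle : Ideal.span {aeval hζ.toInteger X} ≤ RingHom.ker φ.toRingHom := by
    rw [Ideal.span_singleton_le_iff_mem]
    exact (hφX X).trans hX
  have := Ideal.absNorm_dvd_absNorm_of_le hle
  rw [Ideal.absNorm_span_singleton] at this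
  exact hker.trans
    (Nat.le_of_dvd (Int.natAbs_pos.2 (Algebra.norm_ne_zero_iff.2 hX')) this)

/-! ### Upper bound for the norm, by AM-GM and Parseval. -/

/-- If the mean of `‖X(w)‖²` over the complex `k`-th roots of unity `w` is at most `S`, then
the norm of `X(ζ)` for a primitive `k`-th root of unity `ζ` is at most `S ^ (k / 2)`. -/
theorem norm_sq_le_pow_of_sum_le {K : Type*} [Field K] [NumberField K] {k : ℕ} [NeZero k]
    [IsCyclotomicExtension {k} ℚ K] {ζ : K} (hζ : IsPrimitiveRoot ζ k) {ω : ℂ}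
    (hω : IsPrimitiveRoot ω k) (X : ℤ[X]) {S : ℝ} (hS : 3 ≤ S)
    (hsum : ∑ j ∈ Finset.range k, ‖aeval (ω ^ j) X‖ ^ 2 ≤ S * k) :
    ((Algebra.norm ℤ (aeval hζ.toInteger X)).natAbs : ℝ) ^ 2 ≤ S ^ k := by
  classical
  have hS0 : 0 < S := by linarith
  have hval (σ : K →ₐ[ℚ] ℂ) :
      σ ((aeval hζ.toInteger X : NumberField.RingOfIntegers K) : K) = aeval (σ ζ) X := by
    have h1 : ((aeval hζ.toInteger X : NumberField.RingOfIntegers K) : K) = aeval ζ X := by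
      have := aeval_algebraMap_apply K hζ.toInteger X
      exact this.symm
    rw [h1]
    exact (aeval_algHom_apply (σ.restrictScalars ℤ) ζ X).symm
  have hN : ((Algebra.norm ℤ (aeval hζ.toInteger X)).natAbs : ℝ) ^ 2 =
      ∏ σ : K →ₐ[ℚ] ℂ, ‖aeval (σ ζ) X‖ ^ 2 := by
    have h := Algebra.norm_eq_prod_embeddings ℚ ℂ
      ((aeval hζ.toInteger X : NumberField.RingOfIntegers K) : K)
    rw [← Algebra.coe_norm_int] at h
    have h2 := congrArg norm h
    simp only [norm_prod, hval] at h2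
    rw [Finset.prod_pow, ← h2]
    simp [Nat.cast_natAbs]
  have hcard : Fintype.card (K →ₐ[ℚ] ℂ) ≤ k := by
    rw [AlgHom.card, IsCyclotomicExtension.finrank K (cyclotomic.irreducible_rat (NeZero.pos k))]
    exact Nat.totient_le k
  have hinj : Function.Injective fun σ : K →ₐ[ℚ] ℂ => σ ζ := by
    intro σ τ h
    apply (hζ.powerBasis ℚ).algHom_ext
    simpa using h
  have hsum' : ∑ σ : K →ₐ[ℚ] ℂ, ‖aeval (σ ζ) X‖ ^ 2 ≤ S * k := by
    refine le_trans ?_ hsum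
    rw [← Finset.sum_image (s := Finset.univ) (g := fun σ : K →ₐ[ℚ] ℂ => σ ζ)
        (f := fun w : ℂ => ‖aeval w X‖ ^ 2) hinj.injOn,
      ← Finset.sum_image (s := Finset.range k) (g := fun j => ω ^ j)
        (f := fun w : ℂ => ‖aeval w X‖ ^ 2)
        (fun i hi j hj h => hω.pow_inj (by simpa using hi) (by simpa using hj) h)]
    apply Finset.sum_le_sum_of_subset_of_nonneg
    · intro w hw
      obtain ⟨σ, -, rfl⟩ := Finset.mem_image.1 hw
      obtain ⟨i, hi, h⟩ := hω.eq_pow_of_pow_eq_one (ξ := σ ζ)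
        (by rw [← map_pow, hζ.pow_eq_one, map_one])
      exact Finset.mem_image.2 ⟨i, Finset.mem_range.2 hi, h⟩
    · intros; positivity
  -- AM-GM in exponential form, from `t ≤ exp (t - 1)`. There may be fewer than `k` embeddings; the
  -- resulting excess `exp (k - d)` is absorbed because `e < 3 ≤ S`.
  have hterm (σ : K →ₐ[ℚ] ℂ) :
      ‖aeval (σ ζ) X‖ ^ 2 ≤ S * Real.exp (‖aeval (σ ζ) X‖ ^ 2 / S - 1) := by
    have := Real.add_one_le_exp (‖aeval (σ ζ) X‖ ^ 2 / S - 1)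
    rw [sub_add_cancel, div_le_iff₀ hS0] at this
    linarith
  set d := Fintype.card (K →ₐ[ℚ] ℂ) with hd
  calc ((Algebra.norm ℤ (aeval hζ.toInteger X)).natAbs : ℝ) ^ 2
      ≤ ∏ σ : K →ₐ[ℚ] ℂ, (S * Real.exp (‖aeval (σ ζ) X‖ ^ 2 / S - 1)) := by
        rw [hN]
        exact Finset.prod_le_prod (fun _ _ => by positivity) fun σ _ => hterm σ
    _ = S ^ d * Real.exp (∑ σ : K →ₐ[ℚ] ℂ, (‖aeval (σ ζ) X‖ ^ 2 / S - 1)) := by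
        rw [Finset.prod_mul_distrib, ← Real.exp_sum, Finset.prod_const, Finset.card_univ]
    _ ≤ S ^ d * Real.exp ((k - d : ℕ) : ℝ) := by
        gcongr
        rw [Finset.sum_sub_distrib, ← Finset.sum_div, Nat.cast_sub hcard]
        have : (∑ σ : K →ₐ[ℚ] ℂ, ‖aeval (σ ζ) X‖ ^ 2) / S ≤ k := by
          rw [div_le_iff₀ hS0]; linarith
        simp only [Finset.sum_const, Finset.card_univ, nsmul_eq_mul, mul_one]
        linarith
    _ ≤ S ^ d * S ^ (k - d) := by
        gcongr
        rw [← Real.exp_one_pow]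
        gcongr
        linarith [Real.exp_one_lt_three]
    _ = S ^ k := by rw [← pow_add, Nat.add_sub_cancel' hcard]

/-- Orthogonality of the powers of two `k`-th roots of unity. -/
theorem sum_pow_mul_conj_pow {k : ℕ} {u v : ℂ} (hk : k ≠ 0) (hu : u ^ k = 1) (hv : v ^ k = 1) :
    ∑ j ∈ Finset.range k, u ^ j * (starRingEnd ℂ) (v ^ j) = if u = v then (k : ℂ) else 0 := by
  have hv1 : ‖v‖ = 1 := Complex.norm_eq_one_of_pow_eq_one hv hk
  have hv0 : v ≠ 0 := norm_ne_zero_iff.1 (by rw [hv1]; exact one_ne_zero)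
  have hc : (starRingEnd ℂ) v = v⁻¹ := (Complex.inv_eq_conj hv1).symm
  simp_rw [map_pow, hc, ← mul_pow]
  split_ifs with h
  · simp [h, hv0]
  · have hne : u * v⁻¹ - 1 ≠ 0 := by
      rw [sub_ne_zero, ← div_eq_mul_inv, Ne, div_eq_one_iff_eq hv0]
      exact h
    apply (mul_eq_zero.1 ?_).resolve_left hne
    rw [mul_geom_sum, mul_pow, inv_pow, hu, hv]
    simp

/-- Parseval's identity for integral combinations of powers of `k`-th roots of unity. -/
theorem sum_norm_sq_sum_mul_pow {ι : Type*} [Fintype ι] {k : ℕ} (hk : k ≠ 0) (s : ι → ℤ)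
    (u : ι → ℂ) (hu : ∀ t, u t ^ k = 1) :
    ∑ j ∈ Finset.range k, ‖∑ t, (s t : ℂ) * u t ^ j‖ ^ 2 =
      (∑ t, ∑ t', (if u t = u t' then (s t * s t' : ℝ) else 0)) * k := by
  have key : ((∑ j ∈ Finset.range k, ‖∑ t, (s t : ℂ) * u t ^ j‖ ^ 2 : ℝ) : ℂ) =
      ((∑ t, ∑ t', (if u t = u t' then (s t * s t' : ℝ) else 0)) * k : ℝ) := by
    push_cast
    simp_rw [← Complex.mul_conj', map_sum, Finset.sum_mul_sum, map_mul]
    rw [Finset.sum_comm, Finset.sum_mul]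
    refine Finset.sum_congr rfl fun t _ => ?_
    rw [Finset.sum_comm, Finset.sum_mul]
    refine Finset.sum_congr rfl fun t' _ => ?_
    have := sum_pow_mul_conj_pow hk (hu t) (hu t')
    calc _ = (s t * s t' : ℂ) * ∑ j ∈ Finset.range k, u t ^ j * (starRingEnd ℂ) (u t' ^ j) := by
          rw [Finset.mul_sum]
          refine Finset.sum_congr rfl fun j _ => ?_
          simp only [map_intCast]
          ring
      _ = _ := by
          rw [this]
          split_ifs <;> simp
  exact_mod_cast key

/-- For a signed sum of six roots of unity, three of each sign, the mean of the squared modulus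
is at most `14` unless both triples are constant. -/
theorem sum_norm_sq_six_terms_le {k : ℕ} (hk : k ≠ 0) (a b : Fin 3 → ℂ)
    (ha : ∀ i, a i ^ k = 1) (hb : ∀ i, b i ^ k = 1)
    (h : ¬ ((a 0 = a 1 ∧ a 1 = a 2) ∧ (b 0 = b 1 ∧ b 1 = b 2))) :
    ∑ j ∈ Finset.range k, ‖∑ i, a i ^ j - ∑ i, b i ^ j‖ ^ 2 ≤ 14 * k := by
  have hP := sum_norm_sq_sum_mul_pow hk (Sum.elim (fun _ : Fin 3 => (1 : ℤ)) fun _ : Fin 3 => -1)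
    (Sum.elim a b) (by rintro (i | i); exacts [ha i, hb i])
  simp only [Fintype.sum_sum_type, Sum.elim_inl, Sum.elim_inr, Int.cast_one, Int.cast_neg,
    one_mul, neg_one_mul, Finset.sum_neg_distrib, ← sub_eq_add_neg] at hP
  rw [hP]
  gcongr
  have hneg : ∑ i, ∑ i', (if a i = b i' then (-1 : ℝ) else 0) ≤ 0 :=
    Finset.sum_nonpos fun i _ => Finset.sum_nonpos fun i' _ => by split_ifs <;> norm_num
  have hneg' : ∑ i, ∑ i', (if b i = a i' then (-1 : ℝ) else 0) ≤ 0 :=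
    Finset.sum_nonpos fun i _ => Finset.sum_nonpos fun i' _ => by split_ifs <;> norm_num
  -- A constant triple contributes `3² = 9`, any other at most `2² + 1² = 5`. Coincidences across
  -- the two signs only lower the total, so it is at most `9 + 5 = 14`.
  have hsum (c : Fin 3 → ℂ) : ∑ i, ∑ i', (if c i = c i' then (1 : ℝ) else 0) ≤ 9 ∧
      (¬ (c 0 = c 1 ∧ c 1 = c 2) → ∑ i, ∑ i', (if c i = c i' then (1 : ℝ) else 0) ≤ 5) := by
    have e1 : c 1 = c 0 ↔ c 0 = c 1 := eq_comm
    have e2 : c 2 = c 0 ↔ c 0 = c 2 := eq_comm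
    have e3 : c 2 = c 1 ↔ c 1 = c 2 := eq_comm
    simp only [Fin.sum_univ_three, e1, e2, e3, if_true]
    by_cases h1 : c 0 = c 1 <;> by_cases h2 : c 1 = c 2 <;> by_cases h3 : c 0 = c 2 <;>
      simp_all <;> norm_num
  simp only [Finset.sum_add_distrib, neg_neg] at *
  by_cases h1 : a 0 = a 1 ∧ a 1 = a 2
  · have h2 : ¬ (b 0 = b 1 ∧ b 1 = b 2) := fun h2 => h ⟨h1, h2⟩
    linarith [(hsum a).1, (hsum b).2 h2]
  · linarith [(hsum a).2 h1, (hsum b).1]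

/-! ### Three collinear points, in `ℂ` and in `F`. -/

/-- A vanishing `3 × 3` determinant with rows `(1, u i, v i)` of unimodular complex numbers, with
`u` and `v` injective, has proportional columns. -/
theorem mul_eq_mul_of_det_eq_zero_of_norm_eq_one {u v : Fin 3 → ℂ} (hu : ∀ i, ‖u i‖ = 1)
    (hv : ∀ i, ‖v i‖ = 1) (hu01 : u 0 ≠ u 1) (hv02 : v 0 ≠ v 2)
    (h : u 0 * v 1 + u 1 * v 2 + u 2 * v 0 = u 1 * v 0 + u 2 * v 1 + u 0 * v 2) :
    u 1 * v 2 = u 2 * v 1 := by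
  have hu0 (i) : u i ≠ 0 := norm_ne_zero_iff.1 (by rw [hu]; exact one_ne_zero)
  have hv0 (i) : v i ≠ 0 := norm_ne_zero_iff.1 (by rw [hv]; exact one_ne_zero)
  have hcu (i) : (starRingEnd ℂ) (u i) = (u i)⁻¹ := (Complex.inv_eq_conj (hu i)).symm
  have hcv (i) : (starRingEnd ℂ) (v i) = (v i)⁻¹ := (Complex.inv_eq_conj (hv i)).symm
  -- Conjugation inverts every entry and gives a second relation; together they yield `(u 1 - u 0) *
  -- (v 2 - v 0) * (u 1 * v 2 - u 2 * v 1) = 0`.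
  have hconj := congrArg (starRingEnd ℂ) h
  simp only [map_add, map_mul, hcu, hcv] at hconj
  have h0 := hu0 0
  have h1 := hu0 1
  have h2 := hu0 2
  have h3 := hv0 0
  have h4 := hv0 1
  have h5 := hv0 2
  field_simp at hconj
  have hT : (u 1 - u 0) * (v 2 - v 0) ≠ 0 :=
    mul_ne_zero (sub_ne_zero.2 hu01.symm) (sub_ne_zero.2 hv02.symm)
  apply mul_left_cancel₀ hT
  linear_combination u 1 * v 2 * h - hconj

/-- Whether two powers of a primitive `k`-th root of unity agree depends on the exponents only. -/
theorem _root_.IsPrimitiveRoot.pow_eq_pow_iff_pow_eq_pow {M N : Type*} [CommMonoid M] [CommMonoid N]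
    {k : ℕ} [NeZero k] {w : M} {z : N} (hw : IsPrimitiveRoot w k) (hz : IsPrimitiveRoot z k)
    (a b : ℕ) : w ^ a = w ^ b ↔ z ^ a = z ^ b := by
  rw [(hw.isOfFinOrder (NeZero.ne k)).pow_eq_pow_iff_modEq,
    (hz.isOfFinOrder (NeZero.ne k)).pow_eq_pow_iff_modEq, ← hw.eq_orderOf, ← hz.eq_orderOf]

theorem aeval_sum_X_pow_sub {ι R : Type*} [Fintype ι] [CommRing R] (w : R) (a b : ι → ℕ) :
    aeval w (∑ i, X ^ a i - ∑ i, X ^ b i : ℤ[X]) = ∑ i, w ^ a i - ∑ i, w ^ b i := by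
  simp

/-- If a signed sum of six powers of a primitive `k`-th root of unity `z`, three of each sign,
vanishes in characteristic `p`, but the corresponding sum in `ℂ` does not, then `p` is small, unless
both triples are constant. -/
theorem pow_orderOf_sq_le_of_sum_eq {F : Type*} [Field F] [Finite F] {p k : ℕ} [CharP F p]
    [NeZero k] {z : F} (hz : IsPrimitiveRoot z k) (a b : Fin 3 → ℕ)
    (hab : ∑ i, z ^ a i = ∑ i, z ^ b i)
    (hne : ∀ w : ℂ, IsPrimitiveRoot w k → ∑ i, w ^ a i ≠ ∑ i, w ^ b i)
    (h : ¬ ((z ^ a 0 = z ^ a 1 ∧ z ^ a 1 = z ^ a 2) ∧ (z ^ b 0 = z ^ b 1 ∧ z ^ b 1 = z ^ b 2))) :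
    ((p : ℝ) ^ orderOf (p : ZMod k)) ^ 2 ≤ 14 ^ k := by
  have : IsCyclotomicExtension {k} ℚ (CyclotomicField k ℚ) :=
    CyclotomicField.isCyclotomicExtension k ℚ
  have hζ := IsCyclotomicExtension.zeta_spec k ℚ (CyclotomicField k ℚ)
  have hω := Complex.isPrimitiveRoot_exp k (NeZero.ne k)
  set ω := Complex.exp (2 * Real.pi * Complex.I / k)
  have hX0 : aeval hζ.toInteger (∑ i, X ^ a i - ∑ i, X ^ b i : ℤ[X]) ≠ 0 := by
    intro h0
    let σ : CyclotomicField k ℚ →ₐ[ℚ] ℂ := IsAlgClosed.lift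
    refine hne (σ _) (hζ.map_of_injective (f := σ) σ.injective) ?_
    rw [aeval_sum_X_pow_sub, sub_eq_zero] at h0
    have := congrArg (fun y : NumberField.RingOfIntegers (CyclotomicField k ℚ) =>
      σ (algebraMap _ (CyclotomicField k ℚ) y)) h0
    simp only [map_sum, map_pow] at this
    exact this
  have hk (m : ℕ) : (ω ^ m) ^ k = 1 := by rw [pow_right_comm, hω.pow_eq_one, one_pow]
  have hsum := sum_norm_sq_six_terms_le (NeZero.ne k) (fun i => ω ^ a i) (fun i => ω ^ b i)
    (fun i => hk _) (fun i => hk _) (by simpa only [hω.pow_eq_pow_iff_pow_eq_pow hz] using h)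
  refine le_trans ?_ (norm_sq_le_pow_of_sum_le hζ hω (∑ i, X ^ a i - ∑ i, X ^ b i)
    (S := 14) (by norm_num) ?_)
  · gcongr
    exact_mod_cast pow_orderOf_le_natAbs_norm hz hζ _
      (by rw [aeval_sum_X_pow_sub, hab, sub_self]) hX0
  · have hcomm (j m : ℕ) : (ω ^ j) ^ m = (ω ^ m) ^ j := pow_right_comm _ _ _
    simpa only [aeval_sum_X_pow_sub, hcomm _ (a _), hcomm _ (b _)] using hsum

/-- An affine line meets a product of two cosets of the `k`-th roots of unity in at most two
points, provided that `p` is large. -/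
theorem not_three_points_on_line {F : Type*} [Field F] [Finite F] {p k : ℕ} [CharP F p]
    [NeZero k] {z : F} (hz : IsPrimitiveRoot z k)
    (hp : 14 ^ k < ((p : ℝ) ^ orderOf (p : ZMod k)) ^ 2) {α β : F} (hα : α ≠ 0) (hβ : β ≠ 0)
    (m n : Fin 3 → ℕ) (hline : ∀ i, 1 + α * z ^ m i = β * z ^ n i)
    (hm : Function.Injective fun i => z ^ m i) : False := by
  have hn (i j) (hij : i ≠ j) : z ^ n i ≠ z ^ n j := fun h => hij <| hm <| by
    have h1 := hline i
    rw [h, ← hline j] at h1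
    exact mul_left_cancel₀ hα (add_left_cancel h1)
  -- The line misses the origin, so proportional points on it coincide.
  have hprop (i j) (hij : i ≠ j) : z ^ m i * z ^ n j ≠ z ^ m j * z ^ n i := fun h =>
    hn i j hij <| by
      linear_combination z ^ n i * hline j - z ^ n j * hline i + α * h
  have hdet : z ^ m 0 * z ^ n 1 + z ^ m 1 * z ^ n 2 + z ^ m 2 * z ^ n 0 =
      z ^ m 1 * z ^ n 0 + z ^ m 2 * z ^ n 1 + z ^ m 0 * z ^ n 2 := by
    apply mul_left_cancel₀ hβ
    linear_combination (z ^ m 2 - z ^ m 1) * (- hline 0) + (z ^ m 0 - z ^ m 2) * (- hline 1) +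
      (z ^ m 1 - z ^ m 0) * (- hline 2)
  refine hp.not_ge (pow_orderOf_sq_le_of_sum_eq hz ![m 0 + n 1, m 1 + n 2, m 2 + n 0]
    ![m 1 + n 0, m 2 + n 1, m 0 + n 2] ?_ ?_ ?_)
  · simpa [Fin.sum_univ_three, pow_add] using hdet
  · intro w hw h
    have hpow := hw.pow_eq_pow_iff_pow_eq_pow hz
    have hw1 (a : ℕ) : ‖w ^ a‖ = 1 := by
      rw [norm_pow, hw.norm'_eq_one (NeZero.ne k), one_pow]
    refine hprop 1 2 (by decide) ?_
    rw [← pow_add, ← pow_add, ← hpow, pow_add, pow_add]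
    refine mul_eq_mul_of_det_eq_zero_of_norm_eq_one (u := fun i => w ^ m i)
      (v := fun i => w ^ n i) (fun _ => hw1 _) (fun _ => hw1 _) ?_ ?_ ?_
    · exact fun h => by simpa using hm ((hpow _ _).1 h)
    · exact fun h => hn 0 2 (by decide) ((hpow _ _).1 h)
    · simpa [Fin.sum_univ_three, pow_add] using h
  -- Both triples constant: the case where the mean square can exceed 14. The vanishing determinant
  -- is then three times a nonzero difference, so the characteristic is 3; there `z ^ m 0` and `z ^
  -- m 2` have equal cubes, hence are equal.
  · simp only [Matrix.cons_val, pow_add]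
    rintro ⟨⟨ha, ha'⟩, hb, hb'⟩
    have h3mul : (3 : F) * (z ^ m 0 * z ^ n 1 - z ^ m 1 * z ^ n 0) = 0 := by
      linear_combination hdet + 2 * ha + ha' - 2 * hb - hb'
    have h3 : (3 : F) = 0 :=
      (mul_eq_zero.1 h3mul).resolve_right (sub_ne_zero.2 (hprop 0 1 (by decide)))
    have hz0 (c : ℕ) : z ^ c ≠ 0 := pow_ne_zero _ (hz.ne_zero (NeZero.ne k))
    have h0 : (z ^ m 0) ^ 2 = z ^ m 1 * z ^ m 2 := by
      apply mul_right_cancel₀ (hz0 (n 1))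
      linear_combination z ^ m 0 * ha - z ^ m 1 * hb'
    have h2 : (z ^ m 2) ^ 2 = z ^ m 0 * z ^ m 1 := by
      apply mul_right_cancel₀ (hz0 (n 0))
      linear_combination -z ^ m 2 * (ha + ha') - z ^ m 0 * hb
    have hcube : (z ^ m 0 - z ^ m 2) ^ 3 = 0 := by
      linear_combination z ^ m 0 * h0 - z ^ m 2 * h2 -
        z ^ m 0 * z ^ m 2 * (z ^ m 0 - z ^ m 2) * h3
    have h02 := hm (sub_eq_zero.1 (eq_zero_of_pow_eq_zero hcube))
    exact absurd h02 (by decide)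

/-! ### Deduction of the theorem. -/

/-- The bound on `p` with exponents cleared. -/
theorem fourteen_pow_lt {p k d : ℕ} (hd : 0 < d)
    (h : (p : ℝ) > (Real.sqrt 14) ^ ((k : ℝ) / (d : ℝ))) :
    (14 : ℝ) ^ k < ((p : ℝ) ^ d) ^ 2 := by
  have h0 : (0 : ℝ) ≤ Real.sqrt 14 := Real.sqrt_nonneg _
  have h1 : (Real.sqrt 14) ^ k < (p : ℝ) ^ d := by
    have := pow_lt_pow_left₀ h (by positivity) hd.ne'
    rwa [← Real.rpow_mul_natCast h0, div_mul_cancel₀ _ (by positivity), Real.rpow_natCast] at this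
  have := pow_lt_pow_left₀ h1 (by positivity) two_ne_zero
  rwa [← pow_mul, mul_comm k, pow_mul, Real.sq_sqrt (by norm_num)] at this

end CyclotomicBound

open CyclotomicBound

theorem theorem1 {F : Type*} [Field F] [Fintype F] (p n q e k : ℕ)
    (hp : p.Prime) (hq : q = p ^ n) (hF : Fintype.card F = q)
    (he : 1 < e) (hk : 1 < k) (hek : q = e * k + 1)
    (g : Fˣ) (hg : ∀ x : Fˣ, x ∈ Subgroup.zpowers g)
    (hbound : (p : ℝ) > (Real.sqrt 14) ^ ((k : ℝ) / (orderOf (p : ZMod k) : ℝ))) :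
    ∀ a b : ℤ, cyclotomicNumber g e k a b ≤ 3 := by
  intro a b
  have : NeZero k := ⟨by omega⟩
  have : Fact p.Prime := ⟨hp⟩
  have : CharP F p := charP_of_card_eq_prime_pow (hF.trans hq)
  have hgo : orderOf g = e * k := by
    rw [orderOf_eq_card_of_forall_mem_zpowers hg, Nat.card_units, Nat.card_eq_fintype_card, hF, hek,
      Nat.add_sub_cancel]
  have hgp : IsPrimitiveRoot g (e * k) := hgo ▸ IsPrimitiveRoot.orderOf g
  have hz : IsPrimitiveRoot ((g : F) ^ e) k :=
    (IsPrimitiveRoot.coe_units_iff.2 hgp).pow (Nat.mul_pos (by omega) (by omega)) rfl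
  have hn : n ≠ 0 := by
    rintro rfl
    have : 0 < e * k := Nat.mul_pos (by omega) (by omega)
    rw [pow_zero] at hq
    omega
  -- `orderOf` is 0 for elements of infinite order; here `p ^ n = e * k + 1` is 1 modulo `k`, so the
  -- exponent in the bound is a genuine quotient.
  have hord : 0 < orderOf (p : ZMod k) := by
    rw [orderOf_pos_iff, isOfFinOrder_iff_pow_eq_one]
    refine ⟨n, Nat.pos_of_ne_zero hn, ?_⟩
    have : ((p ^ n : ℕ) : ZMod k) = (e * k + 1 : ℕ) := by rw [← hq, hek]
    simpa using this
  have hlt := fourteen_pow_lt hord hbound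
  refine le_trans ?_ (show 2 ≤ 3 by norm_num)
  rw [cyclotomicNumber]
  by_contra! hc
  rw [Set.two_lt_ncard_iff (Set.toFinite _)] at hc
  obtain ⟨x, y, w, ⟨⟨r0, -, hr0⟩, ⟨s0, -, hs0⟩, h0⟩, ⟨⟨r1, -, hr1⟩, ⟨s1, -, hs1⟩, h1⟩,
    ⟨⟨r2, -, hr2⟩, ⟨s2, -, hs2⟩, h2⟩, hxy, hxw, hyw⟩ := hc
  -- Each class is a coset of the group of `k`-th roots of unity generated by `g ^ e`; this supplies
  -- `α = g ^ a` and `β = g ^ b`.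
  have hpow (c : ℤ) (r : ℕ) : ((g ^ (c + (r : ℤ) * (e : ℤ)) : Fˣ) : F) =
      ((g ^ c : Fˣ) : F) * ((g : F) ^ e) ^ r := by
    rw [zpow_add, mul_comm (r : ℤ), zpow_mul, zpow_natCast, zpow_natCast]
    push_cast
    rfl
  rw [hpow] at hr0 hs0 hr1 hs1 hr2 hs2
  have hfst {x y : F × F} (hx : 1 + x.1 = x.2) (hy : 1 + y.1 = y.2) (h : x ≠ y) : x.1 ≠ y.1 :=
    fun h' => h (Prod.ext h' (by rw [← hx, ← hy, h']))
  have hne {x y : F × F} {r s : ℕ} (hx : 1 + x.1 = x.2) (hy : 1 + y.1 = y.2) (h : x ≠ y)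
      (hr : x.1 = ((g ^ a : Fˣ) : F) * ((g : F) ^ e) ^ r)
      (hs : y.1 = ((g ^ a : Fˣ) : F) * ((g : F) ^ e) ^ s) : ((g : F) ^ e) ^ r ≠ ((g : F) ^ e) ^ s :=
    fun h' => hfst hx hy h (by rw [hr, hs, h'])
  have hpts : Function.Injective fun i : Fin 3 => ((g : F) ^ e) ^ (![r0, r1, r2] i) := by
    have h01 := hne h0 h1 hxy hr0 hr1
    have h02 := hne h0 h2 hxw hr0 hr2
    have h12 := hne h1 h2 hyw hr1 hr2
    intro i j hij
    fin_cases i <;> fin_cases j <;>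
      first
      | rfl
      | exact absurd hij h01
      | exact absurd hij h02
      | exact absurd hij h12
      | exact absurd hij.symm h01
      | exact absurd hij.symm h02
      | exact absurd hij.symm h12
  refine not_three_points_on_line hz hlt (Units.ne_zero (g ^ a)) (Units.ne_zero (g ^ b))
    ![r0, r1, r2] ![s0, s1, s2] ?_ hpts
  intro i
  rw [hr0, hs0] at h0
  rw [hr1, hs1] at h1
  rw [hr2, hs2] at h2
  fin_cases i
  exacts [h0, h1, h2]
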